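/- **Theorem 2.** *Model.* Let $1\le K\le L$ be integers and $\bar w\in[0,1]^L$. For every item $e\in[L]=\{1,\dots,L\}$ and round $t=1,2,\dots$ let $w_t(e)$ be a Bernoulli($\bar w(e)$) random variable, all of them independent. In round $t$ the learner plays an ordered list $A_t=(a_1^t,\dots,a_K^t)$ of $K$ distinct items; the user clicks at position $C_t=\inf\{k\in[K]:w_t(a_k^t)=1\}$ ($\inf\emptyset=\infty$), and the learner observes $w_t(a_k^t)$ for $k\le\min\{C_t,K\}$ only. A policy $\pi$ maps the history of past lists and observations to the current list. Its expected regret after $n$ rounds is $$R_{\pi,\bar w}(n)=\mathbb E_{\pi,\bar w}\Big[\sum_{t=1}^n\Big(\prod_{k=1}^K(1-\bar w(a_k^t))-\prod_{k=1}^K(1-\bar w(a_k^*))\Big)\Big],$$ where $(a_1^*,\dots,a_K^*)$ is any list of $K$ distinct items that maximizes the click probability $1-\prod_k(1-\bar w(a_k))$. *Policy.* Let $T_{t-1}(e)$ be the number of observations of item $e$ in rounds $1,\dots,t-1$ and $\hat w(e)$ the mean of these observations ($0$ if there are none). Let $d(p,q)=p\log(p/q)+(1-p)\log((1-p)/(1-q))$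 be the Kullback–Leibler divergence of Bernoulli laws and $f(t)=t(\log t)^3$. The KL-UCB index of $e$ in round $t$ is $$U_t(e)=\max\{u\in[0,1]: d(\hat w(e),u)\le \log(f(t))/T_{t-1}(e)\},$$ with $U_t(e)=1$ if $T_{t-1}(e)=0$, and with an arbitrary value in $[0,1]$ if the set is empty (which happens only for $t=2$). CascadeKL-UCB plays in round $t$ the $K$ items with the highest indices $U_t$, in decreasing order of index, with ties broken arbitrarily. *Claim.* If $\pi$ is CascadeKL-UCB, then $\sup_{\bar w\in[0,1]^L}R_{\pi,\bar w}(n)=\tilde O(\sqrt{nL})$: there are absolute constants $C$ and $m$ such that for all $1\le K\le L$, all such policies $\pi$ and all $n\ge1$, $$\sup_{\bar w\in[0,1]^L}R_{\pi,\bar w}(n)\le C\sqrt{nL}\,(1+\log n)^m .$$ -/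

import Mathlib

open MeasureTheory ProbabilityTheory

noncomputable section

namespace CascadingBandit

/-! ### The cascading bandit model -/

/-- An action: an ordered list of `K` distinct items out of `L` items. -/
abbrev Action (L K : ℕ) : Type := Fin K ↪ Fin L

/-- What the learner sees of one round: the list that was played, and the position of the clicked
item, `⊤` (infinity) if there was no click. The click position `c` is equivalent to the rewards of
the examined items, since those at the positions before `c` are `0` and the one at `c` is `1`. -/
abbrev Round (L K : ℕ) : Type := Action L K × WithTop (Fin K)

/-- The history of the past rounds, the most recent round first. Before round `t` it has
length `t - 1`. -/
abbrev History (L K : ℕ) : Type := List (Round L K)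

/-- A policy maps the history to the current action. -/
abbrev Policy (L K : ℕ) : Type := History L K → Action L K

/-- The position of the first attractive item of the list `A`, given which items are attractive
(`⊤` if none of the listed items is). -/
def click {L K : ℕ} (A : Action L K) (x : Fin L → Bool) : WithTop (Fin K) :=
  (Finset.univ.filter fun k : Fin K => x (A k) = true).min

/-- The history after `t` rounds, when the policy `π` is played and `ω s e` tells whether item `e`
is attractive in the `(s + 1)`-st round. -/
def history {L K : ℕ} (π : Policy L K) (ω : ℕ → Fin L → Bool) : ℕ → History L K
  | 0 => []
  | t + 1 => (π (history π ω t), click (π (history π ω t)) (ω t)) :: history π ω t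

/-- The law of the attraction indicators: they are independent over rounds and items, and the one
of item `e` is Bernoulli with mean `w e` in every round. -/
def attractionLaw {L : ℕ} (w : Fin L → unitInterval) : Measure (ℕ → Fin L → Bool) :=
  Measure.infinitePi fun _ : ℕ => Measure.pi fun e : Fin L => bernoulliMeasure true false (w e)

/-- The probability that the list `A` receives no click. -/
def noClickProb {L K : ℕ} (w : Fin L → unitInterval) (A : Action L K) : ℝ :=
  ∏ k : Fin K, (1 - (w (A k) : ℝ))

/-- `A` maximizes the click probability among all actions. -/
def IsOptimalAction {L K : ℕ} (w : Fin L → unitInterval) (A : Action L K) : Prop :=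
  ∀ B : Action L K, 1 - noClickProb w B ≤ 1 - noClickProb w A

/-- The expected regret of the policy `π` over `n` rounds against always playing `Astar`. -/
def regret {L K : ℕ} (π : Policy L K) (w : Fin L → unitInterval) (Astar : Action L K) (n : ℕ) : ℝ :=
  ∫ ω, ∑ t ∈ Finset.range n, (noClickProb w (π (history π ω t)) - noClickProb w Astar)
    ∂(attractionLaw w)

/-! ### The CascadeKL-UCB policy -/

/-- Item `e` was examined in the round `r`: it is at a position that is not after the click. -/
def Examined {L K : ℕ} (r : Round L K) (e : Fin L) : Prop :=
  ∃ k : Fin K, r.1 k = e ∧ (k : WithTop (Fin K)) ≤ r.2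

/-- Item `e` was clicked in the round `r`. -/
def Clicked {L K : ℕ} (r : Round L K) (e : Fin L) : Prop :=
  ∃ k : Fin K, r.1 k = e ∧ r.2 = (k : WithTop (Fin K))

open Classical in
/-- The number of observations of item `e`. -/
def count {L K : ℕ} : History L K → Fin L → ℕ
  | [], _ => 0
  | r :: h, e => if Examined r e then count h e + 1 else count h e

open Classical in
/-- The empirical mean of the observations of item `e` (`0` if there are none), by the recursive
update. -/
def empMean {L K : ℕ} : History L K → Fin L → ℝ
  | [], _ => 0
  | r :: h, e =>
      if Examined r e then
        ((count h e : ℝ) * empMean h e + (if Clicked r e then 1 else 0)) / (count h e + 1 : ℝ)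
      else empMean h e

open Classical in
/-- The Kullback-Leibler divergence between the Bernoulli laws of means `p, q` in `[0, 1]`:
`p log (p / q) + (1 - p) log ((1 - p) / (1 - q))`, which is infinite if `q = 0 < p` or
`p < 1 = q`; a term with the factor `0` in front is `0`. -/
def bernKL (p q : ℝ) : EReal :=
  if (q = 0 ∧ p ≠ 0) ∨ (q = 1 ∧ p ≠ 1) then ⊤
  else ((p * Real.log (p / q) + (1 - p) * Real.log ((1 - p) / (1 - q)) : ℝ) : EReal)

/-- The exploration function `f t = t (log t) ^ 3`. -/
def explore (t : ℕ) : ℝ := (t : ℝ) * Real.log t ^ 3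

/-- The confidence set in round `t` of an item with `s` observations of mean `p`. There is no
constraint if there are no observations (`log (f t) / 0` stands for infinity). -/
def confSet (t s : ℕ) (p : ℝ) : Set ℝ :=
  {u | u ∈ Set.Icc (0 : ℝ) 1 ∧
    (s = 0 ∨ bernKL p u ≤ ((Real.log (explore t) / s : ℝ) : EReal))}

/-- `u` is the KL-UCB index in round `t` of an item with `s` observations of mean `p`: the largest
element of the confidence set. The confidence set is empty only for `t = 2` and `s > 0`, where
`log (f t) < 0`; the index can then be any number in `[0, 1]`. -/
def IsKLUCBIndex (t s : ℕ) (p u : ℝ) : Prop :=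
  IsGreatest (confSet t s p) u ∨ (confSet t s p = ∅ ∧ u ∈ Set.Icc (0 : ℝ) 1)

/-- `π` is a CascadeKL-UCB policy: after every history, for every position `k`, the item at `k` has
the largest KL-UCB index among the items that are not at an earlier position. Ties are broken
arbitrarily. -/
def IsCascadeKLUCB {L K : ℕ} (π : Policy L K) : Prop :=
  ∀ h : History L K, ∃ U : Fin L → ℝ,
    (∀ e, IsKLUCBIndex (h.length + 1) (count h e) (empMean h e) (U e)) ∧
    ∀ k : Fin K, ∀ e : Fin L, (∀ i < k, π h i ≠ e) → U e ≤ U (π h k)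

end CascadingBandit

end

namespace CascadingBandit

/-! The proof is optimism with confidence widths that adapt to the variance. While every confidence
set contains its mean, the indices dominate the means, so greedy sorting (`prod_one_sub_greedy_le`)
bounds the regret of a round by the gap between the products of `1 - w` and of `1 - U` over the
played list. Telescoping (`prod_sub_prod_le`) bounds this gap by the sum over positions of the
examination probability times `U - w`.

The KL divergence dominates the squared Hellinger distance, whence `U - w ≤ 4 b w + (1 / b + 4) log
f / T` for every `b > 0` (`sub_le_of_bernKL_le`). Weighted by the examination probabilities, the
first term sums to at most `4 b`, because the click probability is at most one; this is why no
factor `K` appears. The weighted sum of `1 / T` is the expected increase of a harmonic potential of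
the observation counts (`integral_potential_succ_sub`), which telescopes over the rounds to order `L
log n`. The choice `b = √(L / n)` balances the two.

Confidence sets fail with probability of order `1 / t` (`integral_not_reliable_le`): of order `log²
t` likelihood-ratio supermartingales, one for each direction and each group of sample sizes, suffice
to make every failure visible as a large value. Over items and rounds this costs order `L log n`. -/

variable {L K : ℕ}

/-! ### Expectation over a single round -/

/-- The probability of the attraction pattern `x` in a single round. -/
noncomputable def roundProb (w : Fin L → unitInterval) (x : Fin L → Bool) : ℝ :=
  ∏ e, if x e then (w e : ℝ) else 1 - w e

/-- The expectation over the attraction pattern of a single round. -/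
noncomputable def roundExp (w : Fin L → unitInterval) (f : (Fin L → Bool) → ℝ) : ℝ :=
  ∑ x, roundProb w x * f x

lemma roundExp_prod (w : Fin L → unitInterval) (g : Fin L → Bool → ℝ) :
    roundExp w (fun x => ∏ e, g e (x e)) =
      ∏ e, ((w e : ℝ) * g e true + (1 - w e) * g e false) := by
  have h : ∀ e, ((w e : ℝ) * g e true + (1 - w e) * g e false) =
      ∑ b : Bool, (if b then (w e : ℝ) else 1 - w e) * g e b := by
    intro e; simp
  simp_rw [h, Finset.prod_univ_sum, Fintype.piFinset_univ, Finset.prod_mul_distrib]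
  rfl

lemma roundExp_const (w : Fin L → unitInterval) (c : ℝ) : roundExp w (fun _ => c) = c := by
  have h := roundExp_prod w (fun _ _ => 1)
  simp only [Finset.prod_const_one, mul_one, add_sub_cancel] at h
  unfold roundExp at h ⊢
  simp only [mul_one] at h
  rw [← Finset.sum_mul, h, one_mul]

lemma roundExp_add (w : Fin L → unitInterval) (f g : (Fin L → Bool) → ℝ) :
    roundExp w (fun x => f x + g x) = roundExp w f + roundExp w g := by
  simp [roundExp, mul_add, Finset.sum_add_distrib]

lemma roundExp_mul_const (w : Fin L → unitInterval) (f : (Fin L → Bool) → ℝ) (c : ℝ) :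
    roundExp w (fun x => f x * c) = roundExp w f * c := by
  simp [roundExp, Finset.sum_mul, mul_assoc]

lemma roundExp_sum {ι : Type*} (s : Finset ι) (w : Fin L → unitInterval)
    (f : ι → (Fin L → Bool) → ℝ) :
    roundExp w (fun x => ∑ i ∈ s, f i x) = ∑ i ∈ s, roundExp w (f i) := by
  simp only [roundExp, Finset.mul_sum]
  exact Finset.sum_comm

/-! ### Histories as random variables -/

instance : MeasurableSpace (History L K) := ⊤
instance : DiscreteMeasurableSpace (History L K) := ⟨fun _ => trivial⟩
instance : Countable (History L K) := inferInstanceAs (Countable (List _))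

instance (w : Fin L → unitInterval) : IsProbabilityMeasure (attractionLaw w) := by
  unfold attractionLaw; infer_instance

lemma history_congr (π : Policy L K) {ω ω' : ℕ → Fin L → Bool} (t : ℕ)
    (h : ∀ s < t, ω s = ω' s) : history π ω t = history π ω' t := by
  induction t with
  | zero => rfl
  | succ t ih =>
    have h1 := ih fun s hs => h s (by omega)
    simp only [history, h1, h t (by omega)]

lemma length_history (π : Policy L K) (ω : ℕ → Fin L → Bool) (t : ℕ) :
    (history π ω t).length = t := by
  induction t with
  | zero => rfl
  | succ t ih => simp [history, ih]

lemma measurable_history (π : Policy L K) (t : ℕ) :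
    Measurable fun ω : ℕ → Fin L → Bool => history π ω t := by
  induction t with
  | zero => exact measurable_const
  | succ t ih =>
    have h : Measurable fun p : History L K × (Fin L → Bool) =>
        ((π p.1, click (π p.1) p.2) :: p.1 : History L K) := Measurable.of_discrete
    exact h.comp (ih.prodMk (measurable_pi_apply t))

/-- This makes every function of the history bounded, hence integrable, so that later integrability
goals need no estimates. -/
lemma finite_range_history (π : Policy L K) (t : ℕ) :
    (Set.range fun ω : ℕ → Fin L → Bool => history π ω t).Finite := by
  induction t with
  | zero => exact Set.toFinite _ |>.subset (s := {[]}) (by rintro _ ⟨ω, rfl⟩; simp [history])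
  | succ t ih =>
    refine ((ih.prod (Set.finite_univ (α := Fin L → Bool))).image
      fun p => ((π p.1, click (π p.1) p.2) :: p.1 : History L K)).subset ?_
    rintro _ ⟨ω, rfl⟩
    exact ⟨(history π ω t, ω t), ⟨⟨ω, rfl⟩, trivial⟩, rfl⟩

lemma integrable_history_round (π : Policy L K) (w : Fin L → unitInterval) (t : ℕ)
    (F : History L K → (Fin L → Bool) → ℝ) :
    Integrable (fun ω => F (history π ω t) (ω t)) (attractionLaw w) := by
  obtain ⟨C, hC⟩ := ((((finite_range_history π t).prod (Set.finite_univ (α := Fin L → Bool))).image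
    fun p => ‖F p.1 p.2‖).bddAbove)
  refine Integrable.of_bound (C := C) ?_ (Filter.Eventually.of_forall fun ω => ?_)
  · have h : Measurable fun p : History L K × (Fin L → Bool) => F p.1 p.2 := Measurable.of_discrete
    exact (h.comp ((measurable_history π t).prodMk (measurable_pi_apply t))).aestronglyMeasurable
  · exact hC ⟨(history π ω t, ω t), ⟨⟨ω, rfl⟩, trivial⟩, rfl⟩

lemma integrable_history (π : Policy L K) (w : Fin L → unitInterval) (t : ℕ)
    (F : History L K → ℝ) :
    Integrable (fun ω => F (history π ω t)) (attractionLaw w) :=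
  integrable_history_round π w t fun h _ => F h

/-- The history before a round is a function of the earlier coordinates only, and the coordinates
are independent. -/
lemma indepFun_history (π : Policy L K) (w : Fin L → unitInterval) (t : ℕ) :
    IndepFun (fun ω : ℕ → Fin L → Bool => history π ω t) (fun ω => ω t) (attractionLaw w) := by
  have h0 : iIndepFun (fun (i : ℕ) (ω : ℕ → Fin L → Bool) => ω i) (attractionLaw w) :=
    iIndepFun_infinitePi (X := fun _ x => x) (by fun_prop)
  have h1 := h0.indepFun_finset (Finset.range t) {t} (by simp) (by fun_prop)
  -- The padding by `false` is never read, by `history_congr`; it only turns a finite block of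
  -- rounds into an argument of `history`.
  let ext : (Finset.range t → Fin L → Bool) → ℕ → Fin L → Bool :=
    fun r s => if h : s ∈ Finset.range t then r ⟨s, h⟩ else fun _ => false
  have h2 := h1.comp (φ := fun r => history π (ext r) t)
    (ψ := fun r : ({t} : Finset ℕ) → Fin L → Bool => r ⟨t, by simp⟩)
    Measurable.of_discrete Measurable.of_discrete
  have h3 : (fun ω : ℕ → Fin L → Bool => history π ω t) =
      (fun r => history π (ext r) t) ∘ fun a (i : Finset.range t) => a i := by
    funext ω
    refine history_congr π t fun s hs => ?_
    simp [ext, hs]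
  rw [h3]
  exact h2

lemma attractionLaw_round (w : Fin L → unitInterval) (t : ℕ) (x : Fin L → Bool) :
    (attractionLaw w).real {ω | ω t = x} = roundProb w x := by
  have h : (attractionLaw w).map (fun ω => ω t) =
      Measure.pi fun e : Fin L => bernoulliMeasure true false (w e) :=
    Measure.infinitePi_map_eval _ t
  have h2 : (attractionLaw w).real {ω | ω t = x} =
      ((attractionLaw w).map (fun ω => ω t)).real {x} := by
    rw [map_measureReal_apply (measurable_pi_apply t) (measurableSet_singleton x)]
    rfl
  rw [h2, h, Measure.real, Measure.pi_singleton, ENNReal.toReal_prod]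
  refine Finset.prod_congr rfl fun e _ => ?_
  change (bernoulliMeasure true false (w e)).real {x e} = _
  cases x e
  · rw [bernoulliMeasure_real_apply_of_notMem_of_mem] <;> simp
  · rw [bernoulliMeasure_real_apply_of_mem_of_notMem] <;> simp

/-- Conditioning on the past: by independence, the current pattern can be averaged out with the
history frozen. -/
lemma integral_round (π : Policy L K) (w : Fin L → unitInterval) (t : ℕ)
    (F : History L K → (Fin L → Bool) → ℝ) :
    ∫ ω, F (history π ω t) (ω t) ∂(attractionLaw w) =
      ∫ ω, roundExp w (F (history π ω t)) ∂(attractionLaw w) := by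
  classical
  have h1 : ∀ ω : ℕ → Fin L → Bool, F (history π ω t) (ω t) =
      ∑ x, F (history π ω t) x * (if ω t = x then 1 else 0) := by
    intro ω; simp
  simp_rw [h1, roundExp]
  rw [integral_finsetSum, integral_finsetSum]
  rotate_left
  · exact fun x _ => integrable_history π w t fun h => roundProb w x * F h x
  · exact fun x _ => integrable_history_round π w t fun h y => F h x * (if y = x then 1 else 0)
  refine Finset.sum_congr rfl fun x _ => ?_
  have h2 := (indepFun_history π w t).comp (φ := fun h => F h x)
    (ψ := fun y => if y = x then (1 : ℝ) else 0) Measurable.of_discrete Measurable.of_discrete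
  have h3 := h2.integral_fun_mul_eq_mul_integral
    (integrable_history π w t fun h => F h x).aestronglyMeasurable
    (integrable_history_round π w t fun _ y => if y = x then 1 else 0).aestronglyMeasurable
  simp only [Function.comp_def] at h3
  rw [h3, integral_const_mul, mul_comm, ← attractionLaw_round w t x]
  congr 1
  have h4 : (fun ω : ℕ → Fin L → Bool => if ω t = x then (1 : ℝ) else 0) =
      Set.indicator {ω | ω t = x} 1 := by
    funext ω; simp [Set.indicator_apply]
  rw [h4, integral_indicator_one]
  have h5 : Measurable fun ω : ℕ → Fin L → Bool => ω t := measurable_pi_apply t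
  exact h5 (measurableSet_singleton x)

/-! ### Examination -/

lemma le_click_iff (A : Action L K) (x : Fin L → Bool) (k : Fin K) :
    (k : WithTop (Fin K)) ≤ click A x ↔ ∀ i < k, x (A i) = false := by
  unfold click
  rw [Finset.le_min_iff]
  simp only [Finset.mem_filter, Finset.mem_univ, true_and, WithTop.coe_le_coe]
  constructor
  · intro h i hi
    by_contra hc
    exact absurd (h i (by simpa using hc)) (not_le.2 hi)
  · intro h i hi
    by_contra hc
    simp [h i (not_le.1 hc)] at hi

lemma click_eq_iff (A : Action L K) (x : Fin L → Bool) (k : Fin K) :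
    click A x = (k : WithTop (Fin K)) ↔ (∀ i < k, x (A i) = false) ∧ x (A k) = true := by
  rw [← le_click_iff]
  constructor
  · intro h
    refine ⟨h.ge, ?_⟩
    simpa using Finset.mem_of_min h
  · rintro ⟨h1, h2⟩
    refine le_antisymm (Finset.min_le (by simpa using h2)) h1

/-- The item at position `k` is examined independently of its own attraction. -/
lemma roundExp_examined (w : Fin L → unitInterval) (A : Action L K) (k : Fin K) (g : Bool → ℝ) :
    roundExp w (fun x => if (∀ i < k, x (A i) = false) then g (x (A k)) else 0) =
      (∏ i ∈ Finset.univ.filter (· < k), (1 - (w (A i) : ℝ))) *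
        (w (A k) * g true + (1 - w (A k)) * g false) := by
  classical
  let S : Finset (Fin L) := (Finset.univ.filter (· < k)).map A
  -- Examination of position `k` concerns the earlier items only, so the integrand is a product of
  -- one factor per item.
  let c : Fin L → Bool → ℝ := fun e b =>
    if e ∈ S then (if b then 0 else 1) else if e = A k then g b else 1
  have hk : A k ∉ S := by simp [S]
  have h1 : ∀ x : Fin L → Bool,
      (if (∀ i < k, x (A i) = false) then g (x (A k)) else 0) = ∏ e, c e (x e) := by
    intro x
    have hx : ∏ e, c e (x e) = (∏ e ∈ S, if x e then (0 : ℝ) else 1) * g (x (A k)) := by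
      rw [← Finset.prod_mul_prod_compl S]
      congr 1
      · exact Finset.prod_congr rfl fun e he => by simp [c, he]
      · rw [Finset.prod_eq_single (A k)]
        · simp [c, hk]
        · intro e he hne
          simp [c, Finset.mem_compl.1 he, hne]
        · intro h; exact absurd (Finset.mem_compl.2 hk) h
    rw [hx, Finset.prod_map]
    split_ifs with h
    · rw [Finset.prod_eq_one, one_mul]
      intro i hi
      simp [h i (by simpa using hi)]
    · push Not at h
      obtain ⟨i, hi, hxi⟩ := h
      rw [Finset.prod_eq_zero (i := i), zero_mul]
      · simpa using hi
      · simpa using hxi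
  simp_rw [h1, roundExp_prod]
  rw [← Finset.prod_mul_prod_compl S, Finset.prod_map]
  congr 1
  · refine Finset.prod_congr rfl fun i hi => ?_
    have : A i ∈ S := Finset.mem_map_of_mem _ hi
    simp [c, this]
  · rw [Finset.prod_eq_single (A k)]
    · simp [c, hk]
    · intro e he hne
      simp [c, Finset.mem_compl.1 he, hne]
    · intro h; exact absurd (Finset.mem_compl.2 hk) h

/-! ### Click counts and the likelihood supermartingale -/

open Classical in
/-- The number of clicks on item `e`. -/
noncomputable def clicks : History L K → Fin L → ℕ
  | [], _ => 0
  | r :: h, e => if Clicked r e then clicks h e + 1 else clicks h e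

lemma Clicked.examined {r : Round L K} {e : Fin L} (h : Clicked r e) : Examined r e := by
  obtain ⟨k, h1, h2⟩ := h
  exact ⟨k, h1, h2.ge⟩

lemma clicks_le_count (h : History L K) (e : Fin L) : clicks h e ≤ count h e := by
  induction h with
  | nil => rfl
  | cons r h ih =>
    simp only [clicks, count]
    by_cases hc : Clicked r e
    · simp only [hc, hc.examined, if_true]; omega
    · simp only [hc, if_false]; split_ifs <;> omega

lemma count_le_length (h : History L K) (e : Fin L) : count h e ≤ h.length := by
  induction h with
  | nil => rfl
  | cons r h ih =>
    simp only [count, List.length_cons]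
    split_ifs <;> omega

lemma empMean_eq (h : History L K) (e : Fin L) : empMean h e = clicks h e / count h e := by
  induction h with
  | nil => simp [empMean, clicks]
  | cons r h ih =>
    have hle := clicks_le_count h e
    have hmul : (count h e : ℝ) * empMean h e = clicks h e := by
      rw [ih]
      rcases Nat.eq_zero_or_pos (count h e) with h0 | h0
      · have : clicks h e = 0 := by omega
        simp [h0, this]
      · have : (count h e : ℝ) ≠ 0 := by positivity
        field_simp
    simp only [empMean, count, clicks]
    by_cases he : Examined r e
    · simp only [he, if_true, hmul]
      split_ifs <;> simp
    · have hc : ¬ Clicked r e := fun hc => he hc.examined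
      simp only [he, hc, if_false, ih]

lemma examined_play_iff (A : Action L K) (x : Fin L → Bool) (k : Fin K) :
    Examined (A, click A x) (A k) ↔ ∀ i < k, x (A i) = false := by
  rw [← le_click_iff]
  constructor
  · rintro ⟨j, hj, h⟩
    rwa [← A.injective hj]
  · intro h; exact ⟨k, rfl, h⟩

lemma clicked_play_iff (A : Action L K) (x : Fin L → Bool) (k : Fin K) :
    Clicked (A, click A x) (A k) ↔ (∀ i < k, x (A i) = false) ∧ x (A k) = true := by
  rw [← click_eq_iff]
  constructor
  · rintro ⟨j, hj, h⟩
    rwa [← A.injective hj]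
  · intro h; exact ⟨k, rfl, h⟩

/-- The supermartingale of a Bernoulli likelihood ratio. -/
lemma integral_likelihood_le_one (π : Policy L K) (w : Fin L → unitInterval) (e : Fin L)
    {α β : ℝ} (hα : 0 ≤ α) (hβ : 0 ≤ β) (h : α * w e + β * (1 - w e) ≤ 1) (t : ℕ) :
    ∫ ω, α ^ clicks (history π ω t) e * β ^ (count (history π ω t) e - clicks (history π ω t) e)
      ∂(attractionLaw w) ≤ 1 := by
  induction t with
  | zero => simp [history, clicks, count]
  | succ t ih =>
    refine le_trans ?_ ih
    have h1 := integral_round π w t (fun h x =>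
      α ^ clicks ((π h, click (π h) x) :: h) e *
        β ^ (count ((π h, click (π h) x) :: h) e - clicks ((π h, click (π h) x) :: h) e))
    simp only [history]
    rw [h1]
    refine integral_mono (integrable_history π w t fun h => roundExp w fun x =>
      α ^ clicks ((π h, click (π h) x) :: h) e *
        β ^ (count ((π h, click (π h) x) :: h) e - clicks ((π h, click (π h) x) :: h) e))
      (integrable_history π w t (fun h => α ^ clicks h e * β ^ (count h e - clicks h e))) fun ω => ?_
    simp only
    generalize history π ω t = H
    set M : ℝ := α ^ clicks H e * β ^ (count H e - clicks H e) with hM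
    have hM0 : 0 ≤ M := by positivity
    by_cases hmem : ∃ k, π H k = e
    · obtain ⟨k, rfl⟩ := hmem
      have h2 : ∀ x : Fin L → Bool,
          α ^ clicks ((π H, click (π H) x) :: H) (π H k) *
            β ^ (count ((π H, click (π H) x) :: H) (π H k) -
              clicks ((π H, click (π H) x) :: H) (π H k)) =
          M + (if (∀ i < k, x (π H i) = false) then
            ((if x (π H k) then α else β) - 1) else 0) * M := by
        intro x
        have hle := clicks_le_count H (π H k)
        simp only [clicks, count, examined_play_iff, clicked_play_iff]
        by_cases hex : ∀ i < k, x (π H i) = false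
        · by_cases hc : x (π H k) = true
          · rw [if_pos ⟨hex, hc⟩, if_pos hex, if_pos hex, if_pos hc, Nat.add_sub_add_right, pow_succ]
            rw [hM]; ring
          · rw [if_neg (fun h => hc h.2), if_pos hex, if_pos hex, if_neg hc,
              Nat.sub_add_comm hle, pow_succ]
            rw [hM]; ring
        · rw [if_neg (fun h => hex h.1), if_neg hex, if_neg hex, hM]; ring
      simp_rw [h2]
      rw [roundExp_add, roundExp_const, roundExp_mul_const,
        roundExp_examined w (π H) k (fun b => (if b then α else β) - 1)]
      simp only [if_true, Bool.false_eq_true, if_false]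
      have hp : 0 ≤ ∏ i ∈ Finset.univ.filter (· < k), (1 - (w (π H i) : ℝ)) :=
        Finset.prod_nonneg fun i _ => by linarith [(w (π H i)).2.2]
      -- The conditional drift is `M` times the examination probability times this quantity.
      have h3 : (w (π H k) : ℝ) * (α - 1) + (1 - w (π H k)) * (β - 1) ≤ 0 := by linarith
      nlinarith [mul_nonneg hp (mul_nonneg (neg_nonneg.2 h3) hM0)]
    · have h2 : ∀ x : Fin L → Bool, ¬ Examined (π H, click (π H) x) e :=
        fun x ⟨k, hk, _⟩ => hmem ⟨k, hk⟩
      have h3 : ∀ x : Fin L → Bool, ¬ Clicked (π H, click (π H) x) e :=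
        fun x hc => h2 x hc.examined
      simp only [clicks, count, h2, h3, if_false, roundExp_const, le_refl, hM]

/-! ### Bernoulli divergences -/

/-- The real-valued divergence, without the cases in which it is infinite. -/
noncomputable def realKL (p q : ℝ) : ℝ :=
  p * Real.log (p / q) + (1 - p) * Real.log ((1 - p) / (1 - q))

lemma bernKL_le_coe_iff (p q c : ℝ) :
    bernKL p q ≤ (c : EReal) ↔ ¬ ((q = 0 ∧ p ≠ 0) ∨ (q = 1 ∧ p ≠ 1)) ∧ realKL p q ≤ c := by
  unfold bernKL realKL
  split_ifs with h
  · simp [h]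
  · simp only [h, not_false_eq_true, true_and, EReal.coe_le_coe_iff]

lemma realKL_symm (p q : ℝ) : realKL (1 - p) (1 - q) = realKL p q := by
  simp [realKL]; ring

lemma bernKL_symm (p q c : ℝ) : bernKL (1 - p) (1 - q) ≤ (c : EReal) ↔ bernKL p q ≤ c := by
  rw [bernKL_le_coe_iff, bernKL_le_coe_iff, realKL_symm]
  have h1 : (1 - q = 0 ↔ q = 1) := ⟨fun h => by linarith, fun h => by linarith⟩
  have h2 : (1 - q = 1 ↔ q = 0) := ⟨fun h => by linarith, fun h => by linarith⟩
  have h3 : (1 - p = 0 ↔ p = 1) := ⟨fun h => by linarith, fun h => by linarith⟩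
  have h4 : (1 - p = 1 ↔ p = 0) := ⟨fun h => by linarith, fun h => by linarith⟩
  rw [ne_eq, ne_eq, h1, h2, h3, h4]
  tauto

/-- This is `log x ≤ x - 1` at `x = √q / √p`, after writing `log (p / q) = -2 log x`. -/
lemma two_mul_sub_sqrt_le {p q : ℝ} (hp : 0 ≤ p) (hq : 0 ≤ q) (h : q = 0 → p = 0) :
    2 * (p - √p * √q) ≤ p * Real.log (p / q) := by
  rcases hp.eq_or_lt with rfl | hp'
  · simp
  have hq' : 0 < q := hq.lt_of_ne fun h0 => hp'.ne' (h h0.symm)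
  have hsp : 0 < √p := Real.sqrt_pos.2 hp'
  have hsq : 0 < √q := Real.sqrt_pos.2 hq'
  have h1 := Real.log_le_sub_one_of_pos (div_pos hsq hsp)
  have h2 : Real.log (p / q) = -2 * Real.log (√q / √p) := by
    rw [Real.log_div hp'.ne' hq'.ne', Real.log_div hsq.ne' hsp.ne', Real.log_sqrt hq,
      Real.log_sqrt hp]
    ring
  have h3 : p * (√q / √p) = √p * √q := by
    nth_rewrite 1 [← Real.mul_self_sqrt hp]
    field_simp
  rw [h2]
  have := mul_le_mul_of_nonneg_left h1 hp
  linarith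

/-- The divergence dominates the squared Hellinger distance. -/
lemma sq_sqrt_sub_sqrt_le {p q c : ℝ} (hp : p ∈ Set.Icc (0 : ℝ) 1) (hq : q ∈ Set.Icc (0 : ℝ) 1)
    (h : bernKL p q ≤ (c : EReal)) : (√p - √q) ^ 2 ≤ c := by
  obtain ⟨h0, hc⟩ := (bernKL_le_coe_iff p q c).1 h
  push Not at h0
  have h1 := two_mul_sub_sqrt_le hp.1 hq.1 fun h => h0.1 h
  have h2 := two_mul_sub_sqrt_le (p := 1 - p) (q := 1 - q) (by linarith [hp.2])
    (by linarith [hq.2]) fun h => by linarith [h0.2 (by linarith)]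
  unfold realKL at hc
  have e1 := Real.sq_sqrt hp.1
  have e2 := Real.sq_sqrt hq.1
  have e3 := Real.sq_sqrt (show 0 ≤ 1 - p by linarith [hp.2])
  have e4 := Real.sq_sqrt (show 0 ≤ 1 - q by linarith [hq.2])
  nlinarith [sq_nonneg (√(1 - p) - √(1 - q))]

/-- Both `√u` and `√v` are within `√c` of `√p`, so `√u ≤ √v + 2 √c`. Squaring leaves the cross term
`4 √v √c`, which is split by the weighted AM-GM inequality with weight `b`. -/
lemma sub_le_of_bernKL_le {p u v c b : ℝ} (hp : p ∈ Set.Icc (0 : ℝ) 1)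
    (hu : u ∈ Set.Icc (0 : ℝ) 1) (hv : v ∈ Set.Icc (0 : ℝ) 1) (hb : 0 < b)
    (h1 : bernKL p u ≤ (c : EReal)) (h2 : bernKL p v ≤ (c : EReal)) :
    u - v ≤ 4 * b * v + (1 / b + 4) * c := by
  have k1 := sq_sqrt_sub_sqrt_le hp hu h1
  have k2 := sq_sqrt_sub_sqrt_le hp hv h2
  have hc : 0 ≤ c := (sq_nonneg _).trans k1
  have l1 := Real.abs_le_sqrt k1
  have l2 := Real.abs_le_sqrt k2
  rw [abs_le] at l1 l2
  have e1 := Real.sq_sqrt hu.1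
  have e2 := Real.sq_sqrt hv.1
  have e3 := Real.sq_sqrt hc
  have n1 := Real.sqrt_nonneg u
  have n2 := Real.sqrt_nonneg v
  have n3 := Real.sqrt_nonneg c
  have h3 : √u ≤ √v + 2 * √c := by linarith
  have h4 : u ≤ v + 4 * (√v * √c) + 4 * c := by
    have := pow_le_pow_left₀ n1 h3 2
    nlinarith
  have h5 : √v * √c ≤ b * v + 1 / (4 * b) * c := by
    have h6 : b * v + 1 / (4 * b) * c - √v * √c = (2 * b * √v - √c) ^ 2 / (4 * b) := by
      field_simp
      nlinarith
    have : 0 ≤ (2 * b * √v - √c) ^ 2 / (4 * b) := by positivity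
    linarith
  have h7 : 4 * (1 / (4 * b) * c) = 1 / b * c := by field_simp
  linarith

/-! ### Grouping the sample sizes -/

/-- Sample sizes with the same value differ at most by the factor `exp (1 / m)`. -/
noncomputable def sizeGroup (m s : ℕ) : ℕ := ⌊(m : ℝ) * Real.log s⌋₊

/-- Equal floors give `log s' - log s ≤ 1 / m ≤ 1 / δ`, and `1 - 1 / δ ≤ exp (-1 / δ)`. Rescaling a
threshold `δ` within a group therefore loses at most one. -/
lemma sub_one_mul_le_of_sizeGroup_eq {m s s' : ℕ} {δ : ℝ} (hδ : 1 ≤ δ) (hm : δ ≤ m) (hs : 1 ≤ s)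
    (hs' : 1 ≤ s') (h : sizeGroup m s = sizeGroup m s') : (δ - 1) * s' ≤ δ * s := by
  have hm0 : (0 : ℝ) < m := by linarith
  have l1 : 0 ≤ Real.log s := Real.log_natCast_nonneg s
  have l2 : 0 ≤ Real.log s' := Real.log_natCast_nonneg s'
  have h1 := Nat.floor_le (mul_nonneg hm0.le l1)
  have h2 := Nat.lt_floor_add_one ((m : ℝ) * Real.log s')
  unfold sizeGroup at h
  rw [← h] at h2
  have hsp : (0 : ℝ) < s := by exact_mod_cast hs
  have hsp' : (0 : ℝ) < s' := by exact_mod_cast hs'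
  have h3 : δ * (Real.log s' - Real.log s) ≤ 1 := by
    by_cases h0 : 0 ≤ Real.log s' - Real.log s
    · have := mul_le_mul_of_nonneg_right hm h0
      linarith
    · nlinarith
  have h4 : 1 - 1 / δ ≤ s / s' := by
    have h5 := Real.add_one_le_exp (Real.log s - Real.log s')
    rw [Real.exp_sub, Real.exp_log hsp, Real.exp_log hsp'] at h5
    have h6 : Real.log s' - Real.log s ≤ 1 / δ := by
      rw [le_div_iff₀ (by linarith)]; linarith
    linarith
  have hδ0 : 0 < δ := by linarith
  rw [le_div_iff₀ hsp'] at h4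
  have h8 := mul_le_mul_of_nonneg_left h4 hδ0.le
  have h9 : δ * ((1 - 1 / δ) * s') = (δ - 1) * s' := by field_simp
  linarith

/-- The log-likelihood ratio is affine in `a` with nonpositive slope, since `z ≤ w`. Hence the worst
case is `a = z s`, where it equals `s` times the divergence. -/
lemma exp_le_pow_mul_pow {w z δ δ' : ℝ} {a s : ℕ} (hw0 : 0 < w) (hw1 : w < 1) (hz0 : 0 ≤ z)
    (hzw : z ≤ w) (has : a ≤ s) (haz : (a : ℝ) ≤ z * s) (hd : δ' ≤ s * realKL z w)
    (hδ : δ ≤ δ') :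
    Real.exp δ ≤ (z / w) ^ a * ((1 - z) / (1 - w)) ^ (s - a) := by
  have hβ : 1 ≤ (1 - z) / (1 - w) := by rw [le_div_iff₀ (by linarith)]; linarith
  have hα0 : 0 ≤ z / w := by positivity
  have hα1 : z / w ≤ 1 := by rw [div_le_iff₀ hw0]; linarith
  have h1 : (z / w) ^ a = Real.exp (a * Real.log (z / w)) := by
    rcases hz0.eq_or_lt with rfl | hz
    · have : a = 0 := by
        have : (a : ℝ) ≤ 0 := by linarith
        exact_mod_cast le_antisymm this (by positivity)
      simp [this]
    · rw [← Real.log_pow, Real.exp_log (by positivity)]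
  have h2 : ((1 - z) / (1 - w)) ^ (s - a) =
      Real.exp ((s - a) * Real.log ((1 - z) / (1 - w))) := by
    rw [← Nat.cast_sub has, ← Real.log_pow, Real.exp_log (by positivity)]
  rw [h1, h2, ← Real.exp_add, Real.exp_le_exp]
  have l1 : Real.log (z / w) ≤ 0 := Real.log_nonpos hα0 hα1
  have l2 : 0 ≤ Real.log ((1 - z) / (1 - w)) := Real.log_nonneg hβ
  unfold realKL at hd
  nlinarith [mul_nonneg (sub_nonneg.2 haz) (neg_nonneg.2 l1), mul_nonneg (sub_nonneg.2 haz) l2]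

/-- A finite family of likelihood ratios detects all deviations of the empirical mean to the
left. -/
lemma exists_likelihood_left {w δ : ℝ} (hw : w ∈ Set.Icc (0 : ℝ) 1) (m N : ℕ) (hδ : 1 ≤ δ)
    (hm : δ ≤ m) :
    ∃ α β : ℕ → ℝ, (∀ j, 0 ≤ α j) ∧ (∀ j, 0 ≤ β j) ∧ (∀ j, α j * w + β j * (1 - w) ≤ 1) ∧
      ∀ s a : ℕ, 1 ≤ s → s ≤ N → a ≤ s → (a / s : ℝ) < w →
        ¬ bernKL (a / s) w ≤ ((δ / s : ℝ) : EReal) →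
        Real.exp (δ - 1) ≤ α (sizeGroup m s) ^ a * β (sizeGroup m s) ^ (s - a) := by
  classical
  rcases hw.1.eq_or_lt with rfl | hw0
  -- No empirical mean lies below `0`.
  · refine ⟨fun _ => 1, fun _ => 1, by simp, by simp, by simp, fun s a _ _ _ h => ?_⟩
    exact absurd h (not_lt.2 (by positivity))
  rcases hw.2.eq_or_lt with rfl | hw1
  -- With `w = 1` a failure has probability zero, so `β` is unconstrained and a single failure may
  -- be rewarded by `exp δ`.
  · refine ⟨fun _ => 1, fun _ => Real.exp δ, by simp, fun _ => (Real.exp_pos _).le, by simp,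
      fun s a hs _ has h _ => ?_⟩
    have hsa : 1 ≤ s - a := by
      have hsp : (0 : ℝ) < s := by exact_mod_cast hs
      rw [div_lt_one hsp] at h
      have : a < s := by exact_mod_cast h
      omega
    simp only [one_pow, one_mul]
    calc Real.exp (δ - 1) ≤ Real.exp δ := Real.exp_le_exp.2 (by linarith)
      _ ≤ _ := le_self_pow₀ (Real.one_le_exp (by linarith)) (by omega)
  let F : ℕ → Finset (ℕ × ℕ) := fun j =>
    ((Finset.Icc 1 N) ×ˢ (Finset.range (N + 1))).filter fun q =>
      q.2 ≤ q.1 ∧ (q.2 / q.1 : ℝ) < w ∧ ¬ bernKL (q.2 / q.1) w ≤ ((δ / q.1 : ℝ) : EReal) ∧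
        sizeGroup m q.1 = j
  have key : ∀ j, ∃ αβ : ℝ × ℝ, 0 ≤ αβ.1 ∧ 0 ≤ αβ.2 ∧ αβ.1 * w + αβ.2 * (1 - w) ≤ 1 ∧
      ∀ q ∈ F j, Real.exp (δ - 1) ≤ αβ.1 ^ q.2 * αβ.2 ^ (q.1 - q.2) := by
    intro j
    rcases (F j).eq_empty_or_nonempty with hF | hF
    · exact ⟨(1, 1), by simp [hF]⟩
    -- The bad mean closest to `w` serves the whole group: the other bad means lie farther to the
    -- left, where its likelihood ratio only grows.
    obtain ⟨q₀, hq₀, hmax⟩ := (F j).exists_max_image (fun q => (q.2 / q.1 : ℝ)) hF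
    set z : ℝ := q₀.2 / q₀.1 with hz
    have hz0 : 0 ≤ z := by positivity
    simp only [F, Finset.mem_filter, Finset.mem_product, Finset.mem_Icc] at hq₀
    obtain ⟨⟨⟨hs0, -⟩, -⟩, -, hzw, hbad, hj⟩ := hq₀
    rw [bernKL_le_coe_iff] at hbad
    have hkl : δ / q₀.1 < realKL z w := by
      by_contra hc
      exact hbad ⟨by rintro (⟨h, -⟩ | ⟨h, -⟩) <;> linarith, not_lt.1 hc⟩
    refine ⟨(z / w, (1 - z) / (1 - w)), by positivity,
      div_nonneg (by linarith) (by linarith), ?_, ?_⟩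
    · have : (1 - w) ≠ 0 := by linarith
      simp only
      rw [div_mul_cancel₀ _ hw0.ne', div_mul_cancel₀ _ this]
      linarith
    · intro q hq
      have hle := hmax q hq
      simp only [F, Finset.mem_filter, Finset.mem_product, Finset.mem_Icc] at hq
      obtain ⟨⟨⟨hs, -⟩, -⟩, has, -, -, hj'⟩ := hq
      have hsp : (0 : ℝ) < q.1 := by exact_mod_cast hs
      have hsp0 : (0 : ℝ) < q₀.1 := by exact_mod_cast hs0
      rw [div_le_iff₀ hsp] at hle
      refine exp_le_pow_mul_pow hw0 hw1 hz0 hzw.le has hle le_rfl ?_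
      have h1 := sub_one_mul_le_of_sizeGroup_eq hδ hm hs hs0 (hj'.trans hj.symm)
      calc δ - 1 ≤ q.1 * (δ / q₀.1) := by
            rw [mul_div_assoc', le_div_iff₀ hsp0]; linarith
        _ ≤ _ := by gcongr
  choose αβ h1 h2 h3 h4 using key
  refine ⟨fun j => (αβ j).1, fun j => (αβ j).2, h1, h2, h3, fun s a hs hN has hlt hbad => ?_⟩
  exact h4 _ (s, a) (by
    simp only [F, Finset.mem_filter, Finset.mem_product, Finset.mem_Icc, Finset.mem_range]
    exact ⟨⟨⟨hs, hN⟩, by omega⟩, has, hlt, hbad, trivial⟩)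

/-- Exchanging successes and failures reflects right deviations into left ones. -/
lemma exists_likelihood_right {w δ : ℝ} (hw : w ∈ Set.Icc (0 : ℝ) 1) (m N : ℕ) (hδ : 1 ≤ δ)
    (hm : δ ≤ m) :
    ∃ α β : ℕ → ℝ, (∀ j, 0 ≤ α j) ∧ (∀ j, 0 ≤ β j) ∧ (∀ j, α j * w + β j * (1 - w) ≤ 1) ∧
      ∀ s a : ℕ, 1 ≤ s → s ≤ N → a ≤ s → w < (a / s : ℝ) →
        ¬ bernKL (a / s) w ≤ ((δ / s : ℝ) : EReal) →
        Real.exp (δ - 1) ≤ α (sizeGroup m s) ^ a * β (sizeGroup m s) ^ (s - a) := by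
  obtain ⟨α, β, h1, h2, h3, h4⟩ := exists_likelihood_left (w := 1 - w)
    ⟨by linarith [hw.2], by linarith [hw.1]⟩ m N hδ hm
  refine ⟨β, α, h2, h1, fun j => by linarith [h3 j], fun s a hs hN has hlt hbad => ?_⟩
  have hsp : (0 : ℝ) < s := by exact_mod_cast hs
  have e : (((s - a : ℕ) : ℝ) / s) = 1 - a / s := by
    rw [Nat.cast_sub has]; field_simp
  have h5 := h4 s (s - a) hs hN (Nat.sub_le _ _) (by rw [e]; linarith)
    (by rw [e, bernKL_symm]; exact hbad)
  rwa [Nat.sub_sub_self has, mul_comm] at h5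

/-! ### Reliability of the confidence sets -/

/-- The confidence set of item `e` contains its mean. -/
def Reliable (w : Fin L → unitInterval) (h : History L K) (e : Fin L) : Prop :=
  (w e : ℝ) ∈ confSet (h.length + 1) (count h e) (empMean h e)

lemma one_le_log_of_three_le {T : ℕ} (hT : 3 ≤ T) : 1 ≤ Real.log T := by
  rw [Real.le_log_iff_exp_le (by positivity)]
  have h : (3 : ℝ) ≤ T := by exact_mod_cast hT
  linarith [Real.exp_one_lt_d9]

/-- From `1 ≤ log T ≤ T` one gets `T ≤ explore T ≤ T ^ 4`. -/
lemma log_explore_bounds {T : ℕ} (hT : 3 ≤ T) :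
    1 ≤ Real.log (explore T) ∧ Real.log (explore T) ≤ 4 * Real.log T ∧ 0 < explore T := by
  have h1 := one_le_log_of_three_le hT
  have hT0 : (0 : ℝ) < T := by positivity
  have h2 : (T : ℝ) ≤ explore T := by
    unfold explore
    exact le_mul_of_one_le_right hT0.le (one_le_pow₀ h1)
  have h3 : explore T ≤ (T : ℝ) ^ 4 := by
    have h4 : Real.log T ≤ T := Real.log_le_self hT0.le
    calc explore T ≤ (T : ℝ) * (T : ℝ) ^ 3 := by unfold explore; gcongr
      _ = _ := by ring
  refine ⟨h1.trans (Real.log_le_log hT0 h2), ?_, hT0.trans_le h2⟩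
  have h5 := Real.log_le_log (hT0.trans_le h2) h3
  rw [Real.log_pow] at h5
  exact_mod_cast h5

lemma sizeGroup_mono (m : ℕ) {s s' : ℕ} (hs : 1 ≤ s) (h : s ≤ s') :
    sizeGroup m s ≤ sizeGroup m s' := by
  refine Nat.floor_le_floor (mul_le_mul_of_nonneg_left (Real.log_le_log ?_ ?_) (by positivity))
  · exact_mod_cast hs
  · exact_mod_cast h

open Classical in
/-- The confidence set of an item fails with a probability of order `1 / t`. -/
lemma integral_not_reliable_le (π : Policy L K) (w : Fin L → unitInterval) (e : Fin L) {t : ℕ}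
    (ht : 2 ≤ t) :
    ∫ ω, (if Reliable w (history π ω t) e then (0 : ℝ) else 1) ∂(attractionLaw w) ≤
      36 / (t + 1 : ℝ) := by
  obtain ⟨hδ1, hδ4, hf⟩ := log_explore_bounds (T := t + 1) (by omega)
  have hℓ := one_le_log_of_three_le (T := t + 1) (by omega)
  set δ := Real.log (explore (t + 1)) with hδ
  set ℓ := Real.log ((t + 1 : ℕ) : ℝ) with hℓdef
  set m := ⌈δ⌉₊ with hm
  have hmδ : δ ≤ m := Nat.le_ceil δ
  set J := sizeGroup m (t + 1) + 1 with hJ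
  obtain ⟨α, β, hα, hβ, hαβ, hleft⟩ := exists_likelihood_left (w e).2 m t hδ1 hmδ
  obtain ⟨α', β', hα', hβ', hαβ', hright⟩ := exists_likelihood_right (w e).2 m t hδ1 hmδ
  let M : ℝ → ℝ → History L K → ℝ := fun a b h => a ^ clicks h e * b ^ (count h e - clicks h e)
  have hM0 : ∀ {a b : ℝ}, 0 ≤ a → 0 ≤ b → ∀ h, 0 ≤ M a b h := fun ha hb h => by
    simp only [M]; positivity
  -- Markov's inequality in pointwise form, with a union over groups and directions.
  have hpt : ∀ ω, (if Reliable w (history π ω t) e then (0 : ℝ) else 1) ≤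
      Real.exp (1 - δ) * ∑ j ∈ Finset.range J,
        (M (α j) (β j) (history π ω t) + M (α' j) (β' j) (history π ω t)) := by
    intro ω
    have hlen := length_history π ω t
    generalize history π ω t = h at hlen
    have hnn : ∀ j ∈ Finset.range J, 0 ≤ M (α j) (β j) h + M (α' j) (β' j) h :=
      fun j _ => add_nonneg (hM0 (hα j) (hβ j) h) (hM0 (hα' j) (hβ' j) h)
    split_ifs with hr
    · exact mul_nonneg (Real.exp_pos _).le (Finset.sum_nonneg hnn)
    · unfold Reliable confSet at hr
      simp only [Set.mem_ofPred_eq, not_and, not_or] at hr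
      obtain ⟨hs, hbad⟩ := hr (w e).2
      rw [empMean_eq, hlen, ← hδ] at hbad
      have hs1 : 1 ≤ count h e := Nat.one_le_iff_ne_zero.2 hs
      have hst : count h e ≤ t := hlen ▸ count_le_length h e
      have hcs := clicks_le_count h e
      have hjJ : sizeGroup m (count h e) ∈ Finset.range J :=
        Finset.mem_range.2 (Nat.lt_succ_of_le (sizeGroup_mono m hs1 (by omega)))
      have hex : Real.exp (δ - 1) ≤ ∑ j ∈ Finset.range J,
          (M (α j) (β j) h + M (α' j) (β' j) h) := by
        refine le_trans ?_ (Finset.single_le_sum hnn hjJ)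
        rcases lt_trichotomy ((clicks h e / count h e : ℝ)) (w e) with hlt | heq | hgt
        · have := hleft _ _ hs1 hst hcs hlt hbad
          linarith [hM0 (hα' (sizeGroup m (count h e))) (hβ' (sizeGroup m (count h e))) h]
        · exfalso
          apply hbad
          rw [heq, bernKL_le_coe_iff]
          refine ⟨by tauto, ?_⟩
          have h0 : realKL (w e : ℝ) (w e) = 0 := by
            have hdiv : ∀ x : ℝ, Real.log (x / x) = 0 := fun x => by
              rcases eq_or_ne x 0 with rfl | hx <;> simp [*]
            simp [realKL, hdiv]
          rw [h0]; positivity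
        · have := hright _ _ hs1 hst hcs hgt hbad
          linarith [hM0 (hα (sizeGroup m (count h e))) (hβ (sizeGroup m (count h e))) h]
      calc (1 : ℝ) = Real.exp (1 - δ) * Real.exp (δ - 1) := by rw [← Real.exp_add]; simp
        _ ≤ _ := mul_le_mul_of_nonneg_left hex (Real.exp_pos _).le
  have hint : ∀ a b : ℝ, Integrable (fun ω => M a b (history π ω t)) (attractionLaw w) :=
    fun a b => integrable_history π w t (M a b)
  have hadd : ∀ j, Integrable (fun ω => M (α j) (β j) (history π ω t) +
      M (α' j) (β' j) (history π ω t)) (attractionLaw w) := fun j => (hint _ _).add (hint _ _)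
  have h1 : ∫ ω, (if Reliable w (history π ω t) e then (0 : ℝ) else 1) ∂(attractionLaw w) ≤
      Real.exp (1 - δ) * (J * 2) := by
    refine (integral_mono (integrable_history π w t fun h => if Reliable w h e then (0 : ℝ) else 1)
      ((integrable_finsetSum _ fun j _ => hadd j).const_mul
        (Real.exp (1 - δ))) hpt).trans ?_
    rw [integral_const_mul]
    refine mul_le_mul_of_nonneg_left ?_ (Real.exp_pos _).le
    rw [integral_finsetSum _ fun j _ => hadd j]
    have h2 : ∀ j ∈ Finset.range J, ∫ ω, (M (α j) (β j) (history π ω t) +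
        M (α' j) (β' j) (history π ω t)) ∂(attractionLaw w) ≤ 2 := by
      intro j _
      rw [integral_add (hint _ _) (hint _ _)]
      have k1 := integral_likelihood_le_one π w e (hα j) (hβ j) (hαβ j) t
      have k2 := integral_likelihood_le_one π w e (hα' j) (hβ' j) (hαβ' j) t
      simp only [M]; linarith
    refine (Finset.sum_le_sum h2).trans ?_
    simp
  refine h1.trans ?_
  -- The group count is of order `log²`, and `exp (-δ)` supplies `log³` in the denominator, so `1 /
  -- (t + 1)` remains with a logarithm to spare.
  have hJle : (J : ℝ) ≤ 6 * ℓ ^ 2 := by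
    have k1 : (m : ℝ) ≤ 5 * ℓ := by
      have := Nat.ceil_lt_add_one (show 0 ≤ δ by linarith)
      linarith
    have k2 : (sizeGroup m (t + 1) : ℝ) ≤ m * ℓ := Nat.floor_le (by positivity)
    have k3 : (m : ℝ) * ℓ ≤ 5 * ℓ * ℓ := mul_le_mul_of_nonneg_right k1 (by linarith)
    rw [hJ]; push_cast
    nlinarith
  have hexp : Real.exp (1 - δ) = Real.exp 1 / ((t + 1 : ℝ) * ℓ ^ 3) := by
    rw [Real.exp_sub, hδ, Real.exp_log hf]
    simp [explore, hℓdef]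
  have ht0 : (0 : ℝ) < t + 1 := by positivity
  have hℓ0 : 0 < ℓ := by linarith
  rw [hexp, div_mul_eq_mul_div, div_le_div_iff₀ (by positivity) ht0]
  have he3 : Real.exp 1 ≤ 3 := by linarith [Real.exp_one_lt_d9]
  calc Real.exp 1 * (J * 2) * (t + 1 : ℝ) ≤ 3 * (6 * ℓ ^ 2 * 2) * (t + 1) := by gcongr
    _ = 36 * ((t + 1 : ℝ) * (ℓ ^ 2 * 1)) := by ring
    _ ≤ 36 * ((t + 1 : ℝ) * (ℓ ^ 2 * ℓ)) := by gcongr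
    _ = _ := by ring

/-! ### Regret of a single round -/

/-- A list sorted greedily by index minimizes the product of the complements. -/
lemma prod_one_sub_greedy_le (U : Fin L → ℝ) (hU : ∀ e, U e ∈ Set.Icc (0 : ℝ) 1)
    (A B : Action L K) (hA : ∀ k : Fin K, ∀ e : Fin L, (∀ i < k, A i ≠ e) → U e ≤ U (A k)) :
    ∏ k, (1 - U (A k)) ≤ ∏ k, (1 - U (B k)) := by
  classical
  set S : Finset (Fin L) := Finset.univ.map A with hS
  set S' : Finset (Fin L) := Finset.univ.map B with hS'
  have e1 : ∏ k, (1 - U (A k)) = ∏ e ∈ S, (1 - U e) := by rw [hS, Finset.prod_map]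
  have e2 : ∏ k, (1 - U (B k)) = ∏ e ∈ S', (1 - U e) := by rw [hS', Finset.prod_map]
  rw [e1, e2, ← Finset.prod_inter_mul_prod_sdiff S S', ← Finset.prod_inter_mul_prod_sdiff S' S,
    Finset.inter_comm S' S]
  have hnn : ∀ e, 0 ≤ 1 - U e := fun e => by linarith [(hU e).2]
  refine mul_le_mul_of_nonneg_left ?_ (Finset.prod_nonneg fun e _ => hnn e)
  have hcard : (S \ S').card = (S' \ S).card := Finset.card_sdiff_comm (by simp [hS, hS'])
  -- Any matching of the differing items works: an item outside the greedy list was available at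
  -- every position, so its index is no larger than any index in the list.
  let σ := Finset.equivOfCardEq hcard
  rw [← Finset.prod_coe_sort (S \ S'), ← Finset.prod_coe_sort (S' \ S), ← Equiv.prod_comp σ]
  refine Finset.prod_le_prod (fun e _ => hnn e) fun e _ => ?_
  have h1 := (Finset.mem_sdiff.1 e.2).1
  have h2 := (Finset.mem_sdiff.1 (σ e).2).2
  obtain ⟨k, -, hk⟩ := Finset.mem_map.1 h1
  have := hA k (σ e) fun i _ hi => h2 (hi ▸ Finset.mem_map_of_mem _ (Finset.mem_univ i))
  rw [← hk]
  change U (σ e) ≤ U (A k) at this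
  linarith

/-- The factors are exchanged one position at a time; the trailing product of `g` is at most `1` and
is dropped. -/
lemma prod_sub_prod_le {K : ℕ} (f g : Fin K → ℝ) (hg : ∀ k, 0 ≤ g k) (hgf : ∀ k, g k ≤ f k)
    (hf : ∀ k, f k ≤ 1) :
    ∏ k, f k - ∏ k, g k ≤
      ∑ k, (∏ i ∈ Finset.univ.filter (· < k), f i) * (f k - g k) := by
  have h := Finset.prod_add_ordered Finset.univ g (fun k => f k - g k)
  simp only [add_sub_cancel] at h
  rw [h, add_sub_cancel_left]
  refine Finset.sum_le_sum fun k _ => ?_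
  have h1 : ∏ j ∈ Finset.univ.filter (k < ·), g j ≤ 1 :=
    Finset.prod_le_one (fun j _ => hg j) fun j _ => (hgf j).trans (hf j)
  have h2 : 0 ≤ (f k - g k) * ∏ i ∈ Finset.univ.filter (· < k), f i :=
    mul_nonneg (sub_nonneg.2 (hgf k)) (Finset.prod_nonneg fun i _ => (hg i).trans (hgf i))
  calc _ ≤ (f k - g k) * (∏ i ∈ Finset.univ.filter (· < k), f i) * 1 :=
        mul_le_mul_of_nonneg_left h1 h2
    _ = _ := by ring

/-- The probability that position `k` of the list `A` is examined. -/
noncomputable def examProb (w : Fin L → unitInterval) (A : Action L K) (k : Fin K) : ℝ :=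
  ∏ i ∈ Finset.univ.filter (· < k), (1 - (w (A i) : ℝ))

lemma examProb_nonneg (w : Fin L → unitInterval) (A : Action L K) (k : Fin K) :
    0 ≤ examProb w A k :=
  Finset.prod_nonneg fun i _ => by linarith [(w (A i)).2.2]

lemma noClickProb_mem_Icc (w : Fin L → unitInterval) (A : Action L K) :
    noClickProb w A ∈ Set.Icc (0 : ℝ) 1 :=
  ⟨Finset.prod_nonneg fun k _ => by linarith [(w (A k)).2.2],
    Finset.prod_le_one (fun k _ => by linarith [(w (A k)).2.2])
      fun k _ => by linarith [(w (A k)).2.1]⟩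

/-- The sum is the click probability, split by the position of the click. -/
lemma sum_examProb_mul_le_one (w : Fin L → unitInterval) (A : Action L K) :
    ∑ k, examProb w A k * w (A k) ≤ 1 := by
  have h := Finset.prod_one_sub_ordered Finset.univ (fun k : Fin K => (w (A k) : ℝ))
  have h2 : ∑ k, examProb w A k * w (A k) =
      ∑ k : Fin K, (w (A k) : ℝ) * ∏ j ∈ Finset.univ.filter (· < k), (1 - (w (A j) : ℝ)) :=
    Finset.sum_congr rfl fun k _ => mul_comm _ _
  have h3 := (noClickProb_mem_Icc w A).1
  unfold noClickProb at h3
  linarith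

lemma empMean_mem_Icc (h : History L K) (e : Fin L) : empMean h e ∈ Set.Icc (0 : ℝ) 1 := by
  rw [empMean_eq]
  refine ⟨by positivity, div_le_one_of_le₀ ?_ (by positivity)⟩
  exact_mod_cast clicks_le_count h e

lemma index_sub_le (w : Fin L → unitInterval) (h : History L K) (e : Fin L) {u b c : ℝ}
    (hb : 0 < b) (hc1 : 1 ≤ c) (hc : (1 / b + 4) * Real.log (explore (h.length + 1)) ≤ c)
    (hu : u ∈ confSet (h.length + 1) (count h e) (empMean h e)) (hr : Reliable w h e) :
    u - w e ≤ 4 * b * w e + c * (1 / (max (count h e) 1 : ℕ)) := by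
  have hw0 := (w e).2.1
  obtain ⟨hu1, hu2⟩ := hu
  obtain ⟨hw1, hw2⟩ := hr
  rcases Nat.eq_zero_or_pos (count h e) with h0 | h0
  · rw [h0]
    -- Without observations the bound is trivial, as `u ≤ 1 ≤ c`.
    simp only [zero_le, sup_of_le_right, Nat.cast_one, div_one, mul_one]
    have := mul_nonneg hb.le hw0
    linarith [hu1.2]
  · have hu3 := hu2.resolve_left h0.ne'
    have hw3 := hw2.resolve_left h0.ne'
    have h1 := sub_le_of_bernKL_le (empMean_mem_Icc h e) hu1 hw1 hb hu3 hw3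
    rw [max_eq_left h0]
    have hs : (0 : ℝ) < count h e := by exact_mod_cast h0
    have h2 : (1 / b + 4) * (Real.log (explore (h.length + 1)) / count h e) ≤
        c * (1 / count h e) := by
      rw [mul_div_assoc', mul_one_div]
      gcongr
    linarith

open Classical in
lemma noClickProb_sub_le {π : Policy L K} (hπ : IsCascadeKLUCB π) (w : Fin L → unitInterval)
    (B : Action L K) (h : History L K) {b c : ℝ} (hb : 0 < b) (hc1 : 1 ≤ c)
    (hc : (1 / b + 4) * Real.log (explore (h.length + 1)) ≤ c) :
    noClickProb w (π h) - noClickProb w B ≤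
      ∑ e, (if Reliable w h e then (0 : ℝ) else 1) + 4 * b +
        c * ∑ k, examProb w (π h) k * (1 / (max (count h (π h k)) 1 : ℕ)) := by
  have hS : 0 ≤ ∑ k, examProb w (π h) k * (1 / (max (count h (π h k)) 1 : ℕ) : ℝ) :=
    Finset.sum_nonneg fun k _ => mul_nonneg (examProb_nonneg w _ k) (by positivity)
  have hI : ∀ e ∈ Finset.univ, (0 : ℝ) ≤ if Reliable w h e then (0 : ℝ) else 1 :=
    fun e _ => by split_ifs <;> norm_num
  have hcS := mul_nonneg (zero_le_one.trans hc1) hS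
  by_cases hall : ∀ e, Reliable w h e
  · obtain ⟨U, hU, hgreedy⟩ := hπ h
    have hconf : ∀ e, U e ∈ confSet (h.length + 1) (count h e) (empMean h e) ∧ (w e : ℝ) ≤ U e := by
      intro e
      rcases hU e with h1 | ⟨h1, -⟩
      · exact ⟨h1.1, h1.2 (hall e)⟩
      · have := hall e
        unfold Reliable at this
        simp [h1] at this
    have hU01 : ∀ e, U e ∈ Set.Icc (0 : ℝ) 1 := fun e => (hconf e).1.1
    have h1 : ∏ k, (1 - U (π h k)) ≤ noClickProb w B :=
      (prod_one_sub_greedy_le U hU01 (π h) B hgreedy).trans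
        (Finset.prod_le_prod (fun k _ => by linarith [(hU01 (B k)).2])
          fun k _ => by linarith [(hconf (B k)).2])
    have h2 := prod_sub_prod_le (fun k => 1 - (w (π h k) : ℝ)) (fun k => 1 - U (π h k))
      (fun k => by linarith [(hU01 (π h k)).2]) (fun k => by linarith [(hconf (π h k)).2])
      (fun k => by linarith [(w (π h k)).2.1])
    have h3 : ∑ k, (∏ i ∈ Finset.univ.filter (· < k), (1 - (w (π h i) : ℝ))) *
        (1 - (w (π h k) : ℝ) - (1 - U (π h k))) ≤
        4 * b * ∑ k, examProb w (π h) k * w (π h k) +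
          c * ∑ k, examProb w (π h) k * (1 / (max (count h (π h k)) 1 : ℕ)) := by
      rw [Finset.mul_sum, Finset.mul_sum, ← Finset.sum_add_distrib]
      refine Finset.sum_le_sum fun k _ => ?_
      have h4 := index_sub_le w h (π h k) hb hc1 hc (hconf _).1 (hall _)
      have h5 := mul_le_mul_of_nonneg_left h4 (examProb_nonneg w (π h) k)
      unfold examProb at h5 ⊢
      linarith
    have h6 := mul_le_mul_of_nonneg_left (sum_examProb_mul_le_one w (π h))
      (show 0 ≤ 4 * b by positivity)
    have h7 := Finset.sum_nonneg hI
    unfold noClickProb at h1 ⊢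
    linarith
  · push Not at hall
    obtain ⟨e, he⟩ := hall
    -- One failed confidence set already pays for the largest possible regret of a round.
    have h1 := Finset.single_le_sum hI (Finset.mem_univ e)
    simp only [he, if_false] at h1
    linarith [(noClickProb_mem_Icc w (π h)).2, (noClickProb_mem_Icc w B).1]

/-! ### The potential of the observation counts -/

/-- The sum of `1 / max i 1` over `i < s`. -/
noncomputable def potential (s : ℕ) : ℝ := ∑ i ∈ Finset.range s, 1 / (max i 1 : ℕ)

lemma potential_mono : Monotone potential := fun _ _ h =>
  Finset.sum_le_sum_of_subset_of_nonneg (Finset.range_mono h) fun _ _ _ => by positivity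

lemma potential_le {n : ℕ} (hn : 1 ≤ n) : potential n ≤ 2 + Real.log n := by
  obtain ⟨k, rfl⟩ : ∃ k, n = k + 1 := ⟨n - 1, by omega⟩
  unfold potential
  rw [Finset.sum_range_succ']
  have h1 := harmonic_le_one_add_log (k + 1)
  have h2 : ∑ i ∈ Finset.range k, (1 / (max (i + 1) 1 : ℕ) : ℝ) = harmonic k := by
    simp [harmonic]
  have h3 : (harmonic k : ℝ) ≤ harmonic (k + 1) := by
    rw [harmonic_succ]; push_cast
    have : (0 : ℝ) ≤ ((k : ℝ) + 1)⁻¹ := by positivity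
    linarith
  rw [h2]
  simp only [zero_le, sup_of_le_right, Nat.cast_one, div_one]
  linarith

/-- Observing an item for the `(s + 1)`-st time raises its potential by `1 / max s 1`, and position
`k` is observed with probability `examProb w A k`. -/
lemma sum_examProb_eq (w : Fin L → unitInterval) (A : Action L K) (h : History L K) :
    roundExp w (fun x => ∑ e, (potential (count ((A, click A x) :: h) e) -
      potential (count h e))) =
      ∑ k, examProb w A k * (1 / (max (count h (A k)) 1 : ℕ)) := by
  classical
  have h1 : ∀ x : Fin L → Bool, ∑ e, (potential (count ((A, click A x) :: h) e) -
      potential (count h e)) = ∑ k, (if (∀ i < k, x (A i) = false) then (1 : ℝ) else 0) *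
        (1 / (max (count h (A k)) 1 : ℕ)) := by
    intro x
    rw [← Finset.sum_subset (Finset.subset_univ (Finset.univ.map A)), Finset.sum_map]
    · refine Finset.sum_congr rfl fun k _ => ?_
      simp only [count, examined_play_iff]
      split_ifs with hex
      · simp [potential, Finset.sum_range_succ]
      · simp
    · intro e _ he
      have h2 : ¬ Examined (A, click A x) e := fun ⟨k, hk, _⟩ =>
        he (hk ▸ Finset.mem_map_of_mem _ (Finset.mem_univ k))
      simp only [count, h2, if_false, sub_self]
  simp_rw [h1]
  rw [roundExp_sum]
  refine Finset.sum_congr rfl fun k _ => ?_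
  rw [roundExp_mul_const, roundExp_examined w A k (fun _ => 1)]
  simp [examProb]

lemma integral_potential_succ_sub (π : Policy L K) (w : Fin L → unitInterval) (t : ℕ) :
    ∫ ω, ∑ e, potential (count (history π ω (t + 1)) e) ∂(attractionLaw w) -
      ∫ ω, ∑ e, potential (count (history π ω t) e) ∂(attractionLaw w) =
      ∫ ω, ∑ k, examProb w (π (history π ω t)) k *
        (1 / (max (count (history π ω t) (π (history π ω t) k)) 1 : ℕ)) ∂(attractionLaw w) := by
  rw [← integral_sub (integrable_history π w (t + 1) fun h => ∑ e, potential (count h e))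
    (integrable_history π w t fun h => ∑ e, potential (count h e))]
  simp_rw [← Finset.sum_sub_distrib, history]
  rw [integral_round π w t fun h x => ∑ e, (potential (count ((π h, click (π h) x) :: h) e) -
      potential (count h e))]
  simp_rw [sum_examProb_eq]

/-! ### Summing the regret over the rounds -/

lemma integral_round_regret_le_one (π : Policy L K) (w : Fin L → unitInterval) (B : Action L K)
    (t : ℕ) :
    ∫ ω, (noClickProb w (π (history π ω t)) - noClickProb w B) ∂(attractionLaw w) ≤ 1 := by
  refine (integral_mono (integrable_history π w t fun h => noClickProb w (π h) -
    noClickProb w B) (integrable_const (1 : ℝ)) fun ω => ?_).trans (by simp)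
  have := (noClickProb_mem_Icc w (π (history π ω t))).2
  have := (noClickProb_mem_Icc w B).1
  simp only; linarith

lemma integral_round_regret_le {π : Policy L K} (hπ : IsCascadeKLUCB π)
    (w : Fin L → unitInterval) (B : Action L K) (hL : 1 ≤ L) {b c : ℝ} (hb : 0 < b) (hc1 : 1 ≤ c)
    (t : ℕ) (hc : 2 ≤ t → (1 / b + 4) * Real.log (explore (t + 1)) ≤ c) :
    ∫ ω, (noClickProb w (π (history π ω t)) - noClickProb w B) ∂(attractionLaw w) ≤
      36 * L * (1 / (t + 1 : ℝ)) + 4 * b +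
        c * (∫ ω, ∑ e, potential (count (history π ω (t + 1)) e) ∂(attractionLaw w) -
          ∫ ω, ∑ e, potential (count (history π ω t) e) ∂(attractionLaw w)) := by
  classical
  have hL' : (1 : ℝ) ≤ L := by exact_mod_cast hL
  rw [integral_potential_succ_sub]
  -- In rounds 1 and 2 the exploration level is not positive, so no concentration is used: the
  -- regret is at most one, which the first term covers.
  rcases lt_or_ge t 2 with ht | ht
  · have h1 := integral_round_regret_le_one π w B t
    have h2 : 0 ≤ ∫ ω, ∑ k, examProb w (π (history π ω t)) k *
        (1 / (max (count (history π ω t) (π (history π ω t) k)) 1 : ℕ) : ℝ) ∂(attractionLaw w) :=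
      integral_nonneg fun ω => Finset.sum_nonneg fun k _ =>
        mul_nonneg (examProb_nonneg w _ k) (by positivity)
    have h3 : (1 : ℝ) / 2 ≤ 1 / (t + 1 : ℝ) := by
      have : (t : ℝ) + 1 ≤ 2 := by exact_mod_cast ht
      gcongr
    have h4 := mul_nonneg (zero_le_one.trans hc1) h2
    nlinarith
  · have i1 : ∀ e, Integrable (fun ω => if Reliable w (history π ω t) e then (0 : ℝ) else 1)
        (attractionLaw w) :=
      fun e => integrable_history π w t fun h => if Reliable w h e then (0 : ℝ) else 1
    have i2 : Integrable (fun ω => ∑ k, examProb w (π (history π ω t)) k *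
        (1 / (max (count (history π ω t) (π (history π ω t) k)) 1 : ℕ) : ℝ)) (attractionLaw w) :=
      integrable_history π w t fun h => ∑ k, examProb w (π h) k *
        (1 / (max (count h (π h k)) 1 : ℕ) : ℝ)
    have i3 : Integrable (fun ω => ∑ e, if Reliable w (history π ω t) e then (0 : ℝ) else 1)
        (attractionLaw w) := integrable_finsetSum _ fun e _ => i1 e
    have i4 : Integrable (fun ω => (∑ e, if Reliable w (history π ω t) e then (0 : ℝ) else 1) +
        4 * b) (attractionLaw w) := i3.add (integrable_const _)
    have h1 := integral_mono (integrable_history π w t fun h => noClickProb w (π h) -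
      noClickProb w B) (i4.add (i2.const_mul c)) fun ω =>
        noClickProb_sub_le hπ w B (history π ω t) hb hc1 (by rw [length_history]; exact hc ht)
    refine h1.trans ?_
    simp only [Pi.add_apply]
    rw [integral_add i4 (i2.const_mul c), integral_const_mul,
      integral_add i3 (integrable_const _), integral_finsetSum _ fun e _ => i1 e]
    have h2 := Finset.sum_le_sum fun e (_ : e ∈ Finset.univ) =>
      integral_not_reliable_le π w e ht
    simp only [Finset.sum_const, Finset.card_univ, Fintype.card_fin, nsmul_eq_mul] at h2
    have h3 : (L : ℝ) * (36 / (t + 1 : ℝ)) = 36 * L * (1 / (t + 1 : ℝ)) := by ring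
    simp only [integral_const, probReal_univ, smul_eq_mul, one_mul]
    linarith

lemma regret_eq_sum (π : Policy L K) (w : Fin L → unitInterval) (B : Action L K) (n : ℕ) :
    regret π w B n = ∑ t ∈ Finset.range n,
      ∫ ω, (noClickProb w (π (history π ω t)) - noClickProb w B) ∂(attractionLaw w) :=
  integral_finsetSum _ fun t _ =>
    integrable_history π w t fun h => noClickProb w (π h) - noClickProb w B

lemma regret_le_rounds (π : Policy L K) (w : Fin L → unitInterval) (B : Action L K) (n : ℕ) :
    regret π w B n ≤ n := by
  rw [regret_eq_sum]
  exact (Finset.sum_le_sum fun t _ => integral_round_regret_le_one π w B t).trans (by simp)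

lemma regret_le {π : Policy L K} (hπ : IsCascadeKLUCB π) (w : Fin L → unitInterval)
    (B : Action L K) (hL : 1 ≤ L) {n : ℕ} (hn : 1 ≤ n) {b : ℝ} (hb : 0 < b) :
    regret π w B n ≤ 36 * L * (1 + Real.log n) + 4 * b * n +
      (1 + (1 / b + 4) * (4 * Real.log n)) * (L * (2 + Real.log n)) := by
  have hlog : 0 ≤ Real.log n := Real.log_natCast_nonneg n
  set c := 1 + (1 / b + 4) * (4 * Real.log n) with hc
  have hc1 : 1 ≤ c := by
    have : 0 ≤ (1 / b + 4) * (4 * Real.log n) := by positivity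
    linarith
  rw [regret_eq_sum]
  have h1 := Finset.sum_le_sum fun t (ht : t ∈ Finset.range n) =>
    integral_round_regret_le hπ w B hL hb hc1 t fun h2 => by
      have h3 := (log_explore_bounds (T := t + 1) (by omega)).2.1
      have h4 : Real.log ((t + 1 : ℕ) : ℝ) ≤ Real.log n :=
        Real.log_le_log (by positivity) (by exact_mod_cast Finset.mem_range.1 ht)
      have h5 : (1 / b + 4) * Real.log (explore (t + 1)) ≤ (1 / b + 4) * (4 * Real.log n) :=
        mul_le_mul_of_nonneg_left (by linarith) (by positivity)
      linarith
  refine h1.trans ?_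
  rw [Finset.sum_add_distrib, Finset.sum_add_distrib, ← Finset.mul_sum _ _ (36 * (L : ℝ)),
    ← Finset.mul_sum _ _ c, Finset.sum_range_sub (fun t => ∫ ω, ∑ e, potential (count (history π ω t) e)
      ∂(attractionLaw w))]
  have h2 : ∑ t ∈ Finset.range n, (1 / (t + 1 : ℝ)) ≤ 1 + Real.log n := by
    refine le_trans (le_of_eq ?_) (harmonic_le_one_add_log n)
    simp [harmonic]
  have h3 : ∫ ω, ∑ e, potential (count (history π ω n) e) ∂(attractionLaw w) ≤
      L * (2 + Real.log n) := by
    refine (integral_mono (integrable_history π w n fun h => ∑ e, potential (count h e))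
      (integrable_const ((L : ℝ) * (2 + Real.log n))) fun ω => ?_).trans (by simp)
    refine (Finset.sum_le_sum (g := fun _ => 2 + Real.log n) fun e _ => ?_).trans
      (by simp [mul_add])
    have h4 := count_le_length (history π ω n) e
    rw [length_history] at h4
    exact (potential_mono h4).trans (potential_le hn)
  have h4 : ∫ ω, ∑ e, potential (count (history π ω 0) e) ∂(attractionLaw w) = 0 := by
    simp [history, count, potential]
  rw [h4, sub_zero]
  have h5 := mul_le_mul_of_nonneg_left h2 (show (0 : ℝ) ≤ 36 * L by positivity)
  have h6 := mul_le_mul_of_nonneg_left h3 (zero_le_one.trans hc1)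
  have h7 : ∑ _t ∈ Finset.range n, 4 * b = 4 * b * n := by simp; ring
  linarith

end CascadingBandit

theorem theorem2 :
    ∃ (C : ℝ) (m : ℕ), ∀ (L K : ℕ), 1 ≤ K → K ≤ L →
      ∀ π : CascadingBandit.Policy L K, CascadingBandit.IsCascadeKLUCB π →
        ∀ n : ℕ, 1 ≤ n → ∀ w : Fin L → unitInterval,
          ∀ Astar : CascadingBandit.Action L K, CascadingBandit.IsOptimalAction w Astar →
            CascadingBandit.regret π w Astar n
              ≤ C * Real.sqrt ((n : ℝ) * (L : ℝ)) * (1 + Real.log (n : ℝ)) ^ m := by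
  refine ⟨80, 2, fun L K hK hKL π hπ n hn w Astar _ => ?_⟩
  have hlog : 0 ≤ Real.log n := Real.log_natCast_nonneg n
  have hn1 : (1 : ℝ) ≤ n := by exact_mod_cast hn
  have hL1 : (1 : ℝ) ≤ L := by exact_mod_cast hK.trans hKL
  have hX := Real.sqrt_nonneg ((n : ℝ) * L)
  set X := Real.sqrt ((n : ℝ) * L) with hXdef
  set ℓ := Real.log (n : ℝ)
  -- If `n < L`, the trivial bound `n ≤ √(n L)` suffices; otherwise `L ≤ √(n L)` absorbs the terms
  -- linear in `L`.
  rcases lt_or_ge n L with hnL | hnL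
  · have hnL' : (n : ℝ) ≤ L := by exact_mod_cast hnL.le
    have h1 : (n : ℝ) ≤ X := Real.le_sqrt_of_sq_le (by nlinarith)
    refine (CascadingBandit.regret_le_rounds π w Astar n).trans (h1.trans ?_)
    have : (1 : ℝ) ≤ (1 + ℓ) ^ 2 := one_le_pow₀ (by linarith)
    nlinarith
  · have hnL' : (L : ℝ) ≤ n := by exact_mod_cast hnL
    have hLX : (L : ℝ) ≤ X := Real.le_sqrt_of_sq_le (by nlinarith)
    have hX0 : 0 < X := by linarith
    have hXX : X * X = n * L := Real.mul_self_sqrt (by positivity)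
    -- The choice `b = X / n = √(L / n)` makes `b n` and `L / b` both equal to `X`.
    have h := CascadingBandit.regret_le hπ w Astar (hK.trans hKL) hn (b := X / n) (by positivity)
    have e1 : 4 * (X / n) * n = 4 * X := by field_simp
    have e2 : 1 / (X / n) * L = X := by
      rw [one_div_div, div_mul_eq_mul_div, div_eq_iff hX0.ne', hXX]
    have e3 : (1 + (1 / (X / n) + 4) * (4 * ℓ)) * (L * (2 + ℓ)) =
        (L + (1 / (X / n) * L + 4 * L) * (4 * ℓ)) * (2 + ℓ) := by ring
    rw [e1, e3, e2] at h
    refine h.trans ?_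
    calc 36 * L * (1 + ℓ) + 4 * X + (L + (X + 4 * L) * (4 * ℓ)) * (2 + ℓ)
        ≤ 36 * X * (1 + ℓ) + 4 * X + (X + (X + 4 * X) * (4 * ℓ)) * (2 + ℓ) := by gcongr
      _ = X * (36 * (1 + ℓ) + 4 + (1 + 20 * ℓ) * (2 + ℓ)) := by ring
      _ ≤ X * (80 * (1 + ℓ) ^ 2) := mul_le_mul_of_nonneg_left (by nlinarith) hX
      _ = _ := by ring
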